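/- Let $\mathcal G$ be a connected undirected graph (without loops) on the nodes $V=\{1,\dots,N\}$, let $\mathcal N_i$ be the set of neighbours of node $i$, and let $\Delta>0$ be a quantization step size, with quantizer $\mathcal Q(u)=\Delta\lfloor u/\Delta\rfloor$. Let $x(0)\in\mathbb R^N$ be an initial state all of whose entries are integer multiples of $\Delta$, and put $\bar x(0)=\frac1N\sum_{i=1}^N x_i(0)$. The asynchronous distributed quantized averaging algorithm $\mathrm{AF}$ generates states $x(t)$, $t=0,1,2,\dots$, where $t$ counts clock ticks. At each tick, independently of all other ticks, the clock that ticks belongs to a node $i$ uniformly distributed on $V$, and node $i$ chooses one of its neighbours $j\in\mathcal N_i$ with equal probability. Let $d=|x_i(t)-x_j(t)|$, and let $\delta=\frac d2$ if $\frac{d}{2\Delta}$ is an integer and $\delta=\mathcal Q(\frac d2)+\Delta$ otherwise. If $x_i(t)\ge x_j(t)$, then $x_i(t+1)=x_i(t)-\delta$ and $x_j(t+1)=x_j(t)+\delta$; otherwise $x_i(t+1)=x_i(t)+\delta$ and $x_j(t+1)=x_j(t)-\delta$. All other nodes keep their values. Let $\mathcal W(x(0))=\{x\in\mathbb R^N :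 x_i=\bar x(0)\text{ for all }i\}$ if $\bar x(0)$ is a multiple of $\Delta$, and $\mathcal W(x(0))=\{x\in\mathbb R^N : x_i\in\{\mathcal Q(\bar x(0)),\mathcal Q(\bar x(0))+\Delta\}\text{ for all }i\}$ otherwise. Let $T_{\rm con}(x(0))=\inf\{t : x(t)\in\mathcal W(x(0))\}$ and $J(x(0))=(\max_i x_i(0)-\min_i x_i(0))/\Delta$. Then for every such $x(0)\notin\mathcal W(x(0))$, $$\mathbb E[T_{\rm con}(x(0))]\le \frac{N^2J(x(0))^2}{8}\Bigl(\frac{8}{27}N^3-1\Bigr).$$ -/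

import Mathlib

open MeasureTheory ProbabilityTheory
open scoped ENNReal

noncomputable section

namespace QuantizedAveraging

/-- `u` is an integer multiple of the quantization step size `Δ`. -/
def IsMultiple (Δ u : ℝ) : Prop := ∃ k : ℤ, u = k * Δ

/-- The uniform quantizer with step size `Δ`: its levels are the multiples of `Δ`, and
`u` is sent to the level `ω` with `u ∈ [ω, ω + Δ)`. -/
def quantize (Δ u : ℝ) : ℝ := ⌊u / Δ⌋ * Δ

/-- The average of the node values. -/
def average {N : ℕ} (x : Fin N → ℝ) : ℝ := (∑ i, x i) / N

/-- The range `(max x - min x) / Δ` of a network state, in units of the step size. -/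
def rangeJ {N : ℕ} (Δ : ℝ) (x : Fin N → ℝ) : ℝ := ((⨆ i, x i) - ⨅ i, x i) / Δ

open Classical in
/-- The set `W(x₀)` of states at quantized average consensus relative to the initial state `x₀`. -/
def consensusSet {N : ℕ} (Δ : ℝ) (x₀ : Fin N → ℝ) : Set (Fin N → ℝ) :=
  if IsMultiple Δ (average x₀) then
    {x | ∀ i, x i = average x₀}
  else
    {x | ∀ i, x i = quantize Δ (average x₀) ∨ x i = quantize Δ (average x₀) + Δ}

open Classical in
/-- The amount exchanged by two nodes whose values are at distance `d`. -/
def exchange (Δ d : ℝ) : ℝ :=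
  if ∃ k : ℤ, d / (2 * Δ) = k then d / 2 else quantize Δ (d / 2) + Δ

open Classical in
/-- The local computation executed by node `i` and its chosen neighbour `j`: the node with the
larger value gives `exchange Δ |x i - x j|` to the other one. -/
def step {N : ℕ} (Δ : ℝ) (x : Fin N → ℝ) (i j : Fin N) : Fin N → ℝ := fun k =>
  let δ := exchange Δ |x i - x j|
  if x i ≥ x j then
    if k = i then x i - δ else if k = j then x j + δ else x k
  else
    if k = i then x i + δ else if k = j then x j - δ else x k

/-- The state after `t` clock ticks, if at tick `s` the active node and the neighbour that it
chooses are `(e s).1` and `(e s).2`. -/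
def state {N : ℕ} (Δ : ℝ) (x₀ : Fin N → ℝ) (e : ℕ → Fin N × Fin N) : ℕ → Fin N → ℝ
  | 0 => x₀
  | t + 1 => step Δ (state Δ x₀ e t) (e t).1 (e t).2

/-- The convergence time, in clock ticks: the first `t` at which the state is in `W(x₀)`
(infinite if there is none). -/
def convergenceTime {N : ℕ} (Δ : ℝ) (x₀ : Fin N → ℝ) (e : ℕ → Fin N × Fin N) : ℝ≥0∞ :=
  ⨅ (t : ℕ) (_ : state Δ x₀ e t ∈ consensusSet Δ x₀), (t : ℝ≥0∞)

/-- The random choices of the asynchronous algorithm on the graph `G`. At every clock tick,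
independently of the other ticks, the clock that ticks belongs to a uniformly distributed node
`i`, which chooses one of its neighbours `j` uniformly. -/
structure IsRandomSelection {N : ℕ} (G : SimpleGraph (Fin N)) [DecidableRel G.Adj]
    {Ω : Type*} [MeasurableSpace Ω] (μ : Measure Ω) (e : ℕ → Ω → Fin N × Fin N) : Prop where
  measurable : ∀ t, Measurable (e t)
  indep : iIndepFun e μ
  law : ∀ t i j, μ {ω | e t ω = (i, j)} =
    if G.Adj i j then (N : ℝ≥0∞)⁻¹ * (G.degree i : ℝ≥0∞)⁻¹ else 0

end QuantizedAveraging

end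

noncomputable section

namespace QuantizedAveraging

/-! Outside `consensusSet` some pair of nodes has values at least 2Δ apart (`mem_consensusSet`). An
exchange between values less than 2Δ apart only swaps them, so until a larger exchange occurs such a
pair performs the interchange process on `G`; a tick of its own edge is itself a larger exchange.
Each larger exchange lowers the squared deviation from the mean by at least 2Δ². Hence the expected
time to consensus is at most deviation/(2Δ²) times a bound `M` on the expected killing time of a
pair (`unsettledTime_le`), and Popoviciu's inequality bounds the quotient by N J²/8.

The main work is M = N(8N³/27 − 1), in `meetingTime_le`. The truncated killing time h satisfies h −
Ph ≤ 1 off the diagonal, so its Dirichlet energy is at most N(N − 1) max h. Conversely (max h)² is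
at most 8N²/27 times the energy (`sq_le_energy`). This is a Thomson-type bound: a unit flow is sent
from (a, b) to the diagonal through pairs of vertices of a geodesic from a to b, and Cauchy–Schwarz
is applied (`sq_corner_le`). The flow is cheap because a vertex has at most three neighbours on a
geodesic, which limits the degrees along it (`edgeWeight_bounds`). -/

/-! ### Flow energy on a triangle -/

/-- The energy of the flow on the triangle `i ≤ j ≤ k` that sends the corner `(0, k)` to the diagonal:
it moves the first coordinate up to a random `m`, of law proportional to `s`, and then the second
coordinate down to `m`. -/
lemma sq_corner_le (H : ℕ → ℕ → ℝ) (s : ℕ → ℝ) (k : ℕ) (hs : ∀ i < k, 0 < s i)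
    (hH : ∀ i, H i i = 0) :
    3 * (∑ i ∈ Finset.range k, s i) ^ 2 * H 0 k ^ 2 ≤
      ((∑ i ∈ Finset.range k, s i) ^ 3 + 2 * ∑ i ∈ Finset.range k, s i ^ 3) *
      ∑ i ∈ Finset.range k, (s i)⁻¹ * ((∑ m ∈ Finset.range (i + 1), (H m (i + 1) - H m i) ^ 2) +
        if i + 1 < k then (H i k - H (i + 1) k) ^ 2 else 0) := by
  set W : ℕ → ℝ := fun i => ∑ j ∈ Finset.Ico i k, s j with hWdef
  have hW0 : ∑ i ∈ Finset.range k, s i = W 0 := by simp [hWdef]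
  have hWk : W k = 0 := by simp [hWdef]
  have hWs : ∀ i < k, W i = s i + W (i + 1) := fun i hi => by
    simp only [hWdef]; rw [Finset.sum_eq_sum_Ico_succ_bot hi]
  -- Decomposition along the flow, scaled by the total weight: `s m` passes through each step of the
  -- second coordinate at height m, and the tail `W (i + 1)` through the step of the first
  -- coordinate from i to i + 1.
  have hrow : W 0 * H 0 k = ∑ i ∈ Finset.range k,
      ((∑ m ∈ Finset.range (i + 1), s m * (H m (i + 1) - H m i)) +
        W (i + 1) * (H i k - H (i + 1) k)) := by
    rw [Finset.sum_add_distrib]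
    have h1 : ∑ i ∈ Finset.range k, ∑ m ∈ Finset.range (i + 1), s m * (H m (i + 1) - H m i) =
        ∑ m ∈ Finset.range k, s m * H m k := by
      rw [Finset.sum_comm' (t' := Finset.range k) (s' := fun m => Finset.Ico m k)
        (by intro x y; simp only [Finset.mem_range, Finset.mem_Ico]; omega)]
      refine Finset.sum_congr rfl fun m hm => ?_
      rw [← Finset.mul_sum, Finset.sum_Ico_sub _ (Finset.mem_range.1 hm).le, hH, sub_zero]
    rw [h1, ← Finset.sum_add_distrib]
    have h2 : ∀ i ∈ Finset.range k, s i * H i k + W (i + 1) * (H i k - H (i + 1) k) =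
        W i * H i k - W (i + 1) * H (i + 1) k := fun i hi => by
      rw [hWs i (Finset.mem_range.1 hi)]; ring
    rw [Finset.sum_congr rfl h2, Finset.sum_range_sub' (fun i => W i * H i k), hWk]
    ring
  -- Energy of the flow when each step across the path edge i has resistance `s i`; up to 2/3 of the
  -- cubes it telescopes in W³/3.
  have hen : ∑ i ∈ Finset.range k, s i * ((∑ m ∈ Finset.range (i + 1), s m ^ 2) + W (i + 1) ^ 2) =
      (W 0 ^ 3 + 2 * ∑ i ∈ Finset.range k, s i ^ 3) / 3 := by
    have h1 : ∑ i ∈ Finset.range k, s i * ∑ m ∈ Finset.range (i + 1), s m ^ 2 =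
        ∑ m ∈ Finset.range k, s m ^ 2 * W m := by
      simp_rw [Finset.mul_sum, hWdef]
      rw [Finset.sum_comm' (t' := Finset.range k) (s' := fun m => Finset.Ico m k)
        (by intro x y; simp only [Finset.mem_range, Finset.mem_Ico]; omega)]
      refine Finset.sum_congr rfl fun m _ => ?_
      rw [Finset.mul_sum]
      exact Finset.sum_congr rfl fun _ _ => mul_comm _ _
    simp_rw [mul_add]
    rw [Finset.sum_add_distrib, h1, ← Finset.sum_add_distrib]
    have h2 : ∀ i ∈ Finset.range k, s i ^ 2 * W i + s i * W (i + 1) ^ 2 =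
        (W i ^ 3 / 3 - W (i + 1) ^ 3 / 3) + 2 / 3 * s i ^ 3 := fun i hi => by
      rw [hWs i (Finset.mem_range.1 hi)]; ring
    rw [Finset.sum_congr rfl h2, Finset.sum_add_distrib,
      Finset.sum_range_sub' (fun i => W i ^ 3 / 3), hWk, ← Finset.mul_sum]
    ring
  -- Cauchy–Schwarz among the steps across the edge i; the extra slot i + 1 holds the step of the
  -- first coordinate. For i + 1 = k that slot carries no flow, so the edge into (k, k) need not be
  -- charged.
  have hinner : ∀ i ∈ Finset.range k,
      ((∑ m ∈ Finset.range (i + 1), s m * (H m (i + 1) - H m i)) +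
        W (i + 1) * (H i k - H (i + 1) k)) ^ 2 ≤
      (s i * ((∑ m ∈ Finset.range (i + 1), s m ^ 2) + W (i + 1) ^ 2)) *
      ((s i)⁻¹ * ((∑ m ∈ Finset.range (i + 1), (H m (i + 1) - H m i) ^ 2) +
        if i + 1 < k then (H i k - H (i + 1) k) ^ 2 else 0)) := by
    intro i hi
    have hi' := Finset.mem_range.1 hi
    have hsi := (hs i hi').ne'
    have key := Finset.sum_mul_sq_le_sq_mul_sq (Finset.range (i + 1 + 1))
      (fun m => if m < i + 1 then s m else W (i + 1))
      (fun m => if m < i + 1 then H m (i + 1) - H m i else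
        if i + 1 < k then H i k - H (i + 1) k else 0)
    have e1 : ∀ m ∈ Finset.range (i + 1), m < i + 1 := fun m hm => Finset.mem_range.1 hm
    simp only [Finset.sum_range_succ _ (i + 1), lt_irrefl, if_false] at key
    have e3 : ∀ (f : ℕ → ℝ → ℝ → ℝ) (y z : ℝ), ∑ m ∈ Finset.range (i + 1),
        f m (if m < i + 1 then s m else y) (if m < i + 1 then H m (i + 1) - H m i else z) =
        ∑ m ∈ Finset.range (i + 1), f m (s m) (H m (i + 1) - H m i) := fun f y z =>
      Finset.sum_congr rfl fun m hm => by rw [if_pos (e1 m hm), if_pos (e1 m hm)]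
    rw [e3 (fun _ x y => x * y), e3 (fun _ x _ => x ^ 2) _ 0, e3 (fun _ _ y => y ^ 2) 0] at key
    have e2 : (s i * ((∑ m ∈ Finset.range (i + 1), s m ^ 2) + W (i + 1) ^ 2)) *
      ((s i)⁻¹ * ((∑ m ∈ Finset.range (i + 1), (H m (i + 1) - H m i) ^ 2) +
        if i + 1 < k then (H i k - H (i + 1) k) ^ 2 else 0)) =
      ((∑ m ∈ Finset.range (i + 1), s m ^ 2) + W (i + 1) ^ 2) *
      ((∑ m ∈ Finset.range (i + 1), (H m (i + 1) - H m i) ^ 2) +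
        (if i + 1 < k then H i k - H (i + 1) k else 0) ^ 2) := by
      split_ifs <;> field_simp
      ring
    rw [e2]
    refine le_trans (le_of_eq ?_) key
    by_cases h : i + 1 < k
    · rw [if_pos h]
    · have : i + 1 = k := by omega
      rw [if_neg h, this, hWk]; simp
  have hcs := Finset.sum_sq_le_sum_mul_sum_of_sq_le_mul (Finset.range k)
    (fun i hi => mul_nonneg (hs i (Finset.mem_range.1 hi)).le
      (add_nonneg (Finset.sum_nonneg fun _ _ => sq_nonneg _) (sq_nonneg (W (i + 1)))))
    (fun i hi => mul_nonneg (inv_nonneg.2 (hs i (Finset.mem_range.1 hi)).le)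
      (add_nonneg (Finset.sum_nonneg fun m _ => sq_nonneg (H m (i + 1) - H m i))
        (by split_ifs <;> positivity))) hinner
  rw [← hrow, hen] at hcs
  rw [hW0]
  nlinarith [hcs]

/-- The bound on the flow energy in terms of the size `N` of the network. -/
lemma cube_add_le {n S Q : ℝ} (hn : 0 < n) (hS0 : 0 ≤ S) (hS : S ≤ 3 / 2 * n)
    (h1 : Q ≤ 9 / 32 * n ^ 3) (h2 : Q ≤ n ^ 2 / 4 * S) (h3 : Q ≤ S ^ 3) :
    S ^ 3 + 2 * Q ≤ 16 / 9 * n * S ^ 2 := by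
  obtain ⟨t, rfl⟩ : ∃ t, S = t * n := ⟨S / n, by field_simp⟩
  obtain ⟨q, rfl⟩ : ∃ q, Q = q * n ^ 3 := ⟨Q / n ^ 3, by field_simp⟩
  have hn3 : 0 < n ^ 3 := by positivity
  have ht : t ≤ 3 / 2 := le_of_mul_le_mul_right hS hn
  have ht0 : 0 ≤ t := nonneg_of_mul_nonneg_left hS0 hn
  have h1' : q ≤ 9 / 32 := le_of_mul_le_mul_right h1 hn3
  have h2' : q ≤ t / 4 := le_of_mul_le_mul_right (by linarith [h2] : q * n ^ 3 ≤ t / 4 * n ^ 3) hn3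
  have h3' : q ≤ t ^ 3 := le_of_mul_le_mul_right (by linarith [h3] : q * n ^ 3 ≤ t ^ 3 * n ^ 3) hn3
  -- The thresholds are where the bounds on q cross: t³ = t/4 at 1/2, and t/4 = 9/32 at 9/8.
  have key : t ^ 3 + 2 * q ≤ 16 / 9 * t ^ 2 := by
    rcases le_total t (1 / 2) with h | h
    · nlinarith [mul_nonneg (mul_nonneg ht0 ht0) (sub_nonneg.2 h)]
    rcases le_total t (9 / 8) with h' | h'
    · nlinarith [mul_nonneg ht0 (mul_nonneg (sub_nonneg.2 h) (sub_nonneg.2 h'))]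
    · nlinarith [mul_nonneg (sub_nonneg.2 h') (sub_nonneg.2 ht),
        mul_nonneg (mul_nonneg (sub_nonneg.2 h') (sub_nonneg.2 ht)) ht0]
  nlinarith [mul_le_mul_of_nonneg_right key hn3.le]

/-! ### Degrees along a geodesic -/

lemma exists_geodesic {V : Type*} {G : SimpleGraph V} (hG : G.Connected) (a b : V) :
    ∃ v : ℕ → V, v 0 = a ∧ v (G.dist a b) = b ∧ (∀ i < G.dist a b, G.Adj (v i) (v (i + 1))) ∧
      ∀ i ≤ G.dist a b, G.dist a (v i) = i := by
  obtain ⟨p, hp⟩ := hG.exists_walk_length_eq_dist a b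
  refine ⟨p.getVert, p.getVert_zero, by rw [← hp, p.getVert_length],
    fun i hi => p.adj_getVert_succ (hp ▸ hi), fun i hi => ?_⟩
  have h1 := SimpleGraph.dist_le (p.take i)
  have h2 := SimpleGraph.dist_le (p.drop i)
  have h3 := hG.dist_triangle (u := a) (v := p.getVert i) (w := b)
  rw [p.take_length] at h1
  rw [p.drop_length] at h2
  omega

/-- A vertex is adjacent only to the vertices of a geodesic whose distance to the root differs by at
most one from its own. -/
lemma indicator_le {V : Type*} {G : SimpleGraph V} [DecidableRel G.Adj] (hG : G.Connected) {a : V} {v : ℕ → V}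
    {k : ℕ} (hd : ∀ i ≤ k, G.dist a (v i) = i) (w : V) {i : ℕ} (hi : i < k) :
    ((if G.Adj (v i) w then 1 else 0) + if G.Adj (v (i + 1)) w then 1 else 0 : ℝ) ≤ 2 ∧
    ((if G.Adj (v i) w then 1 else 0) + if G.Adj (v (i + 1)) w then 1 else 0 : ℝ) ≤
      (if i + 2 = G.dist a w then 1 else 0) + (if i + 1 = G.dist a w then 2 else 0) +
      (if i = G.dist a w then 2 else 0) + (if i = G.dist a w + 1 then 1 else 0) ∧
    ((if G.Adj (v i) w then 1 else 0) + if G.Adj (v (i + 1)) w then 1 else 0 : ℝ) ^ 3 ≤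
      (if i + 2 = G.dist a w then 1 else 0) + (if i + 1 = G.dist a w then 8 else 0) +
      (if i = G.dist a w then 8 else 0) + (if i = G.dist a w + 1 then 1 else 0) := by
  have key : ∀ j ≤ k, G.Adj (v j) w → j ≤ G.dist a w + 1 ∧ G.dist a w ≤ j + 1 := by
    intro j hj hadj
    have h1 := hG.dist_triangle (u := a) (v := v j) (w := w)
    have h2 := hG.dist_triangle (u := a) (v := w) (w := v j)
    rw [SimpleGraph.dist_comm (u := w)] at h2
    rw [SimpleGraph.dist_eq_one_iff_adj.2 hadj, hd j hj] at *
    omega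
  have k1 := key i hi.le
  have k2 := key (i + 1) hi
  generalize G.dist a w = D at *
  refine ⟨by split_ifs <;> norm_num, ?_, ?_⟩
  all_goals
    by_cases h1 : G.Adj (v i) w <;> by_cases h2 : G.Adj (v (i + 1)) w <;>
      simp only [h1, h2, forall_const, if_true, if_false] at k1 k2 ⊢ <;>
      split_ifs <;> first | (exfalso; omega) | norm_num

/-- An upper bound of the resistance of an edge, up to the factor `N`. -/
def edgeWeight {N : ℕ} (G : SimpleGraph (Fin N)) [DecidableRel G.Adj] (x y : Fin N) : ℝ :=
  ((G.degree x : ℝ) + G.degree y) / 4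

lemma sum_ite_le (k : ℕ) (f : ℕ → Prop) [DecidablePred f] (hf : ∀ i j, f i → f j → i = j) {c : ℝ}
    (hc : 0 ≤ c) : ∑ i ∈ Finset.range k, (if f i then c else 0) ≤ c := by
  rw [← Finset.sum_filter]
  have : (Finset.filter f (Finset.range k)).card ≤ 1 := Finset.card_le_one.2 fun i hi j hj =>
    hf i j (Finset.mem_filter.1 hi).2 (Finset.mem_filter.1 hj).2
  rw [Finset.sum_const, nsmul_eq_mul]
  have h : ((Finset.filter f (Finset.range k)).card : ℝ) ≤ 1 := by exact_mod_cast this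
  nlinarith

/-- Double counting: a vertex at distance D from the root is adjacent to geodesic vertices of index
D − 1, D, D + 1 only. So its contributions to the successive edges are at most 1, 2, 2, 1, with sum
6 and sum of cubes 18. -/
lemma edgeWeight_bounds {N : ℕ} {G : SimpleGraph (Fin N)} [DecidableRel G.Adj] (hG : G.Connected)
    {a : Fin N} {v : ℕ → Fin N} {k : ℕ} (hd : ∀ i ≤ k, G.dist a (v i) = i) :
    (∀ i < k, edgeWeight G (v i) (v (i + 1)) ≤ N / 2) ∧
    ∑ i ∈ Finset.range k, edgeWeight G (v i) (v (i + 1)) ≤ 3 / 2 * N ∧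
    ∑ i ∈ Finset.range k, edgeWeight G (v i) (v (i + 1)) ^ 3 ≤ 9 / 32 * (N : ℝ) ^ 3 := by
  set y : ℕ → Fin N → ℝ := fun i w =>
    (if G.Adj (v i) w then 1 else 0) + if G.Adj (v (i + 1)) w then 1 else 0 with hy
  have hy0 : ∀ i w, 0 ≤ y i w := fun i w => by simp only [hy]; positivity
  have hdeg : ∀ x, (G.degree x : ℝ) = ∑ w, if G.Adj x w then 1 else 0 := by
    intro x
    rw [← SimpleGraph.card_neighborFinset_eq_degree, SimpleGraph.neighborFinset_eq_filter,
      Finset.card_filter]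
    push_cast; rfl
  have hs : ∀ i, edgeWeight G (v i) (v (i + 1)) = (∑ w, y i w) / 4 := by
    intro i
    rw [edgeWeight, hdeg, hdeg, ← Finset.sum_add_distrib]
  have hwin : ∀ (w : Fin N) (c : ℝ), 0 ≤ c → ∑ i ∈ Finset.range k,
      ((if i + 2 = G.dist a w then 1 else 0) + (if i + 1 = G.dist a w then c else 0) +
      (if i = G.dist a w then c else 0) + (if i = G.dist a w + 1 then 1 else 0) : ℝ) ≤
      2 + 2 * c := by
    intro w c hc
    simp only [Finset.sum_add_distrib]
    have h1 := sum_ite_le k (fun i => i + 2 = G.dist a w) (by omega) (zero_le_one' ℝ)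
    have h2 := sum_ite_le k (fun i => i + 1 = G.dist a w) (by omega) hc
    have h3 := sum_ite_le k (fun i => i = G.dist a w) (by omega) hc
    have h4 := sum_ite_le k (fun i => i = G.dist a w + 1) (by omega) (zero_le_one' ℝ)
    linarith
  refine ⟨fun i hi => ?_, ?_, ?_⟩
  · rw [hs]
    have : ∑ w, y i w ≤ ∑ _w : Fin N, (2 : ℝ) :=
      Finset.sum_le_sum fun w _ => (indicator_le hG hd w hi).1
    simp at this
    linarith
  · simp_rw [hs]
    rw [← Finset.sum_div, Finset.sum_comm]
    have : ∑ w, ∑ i ∈ Finset.range k, y i w ≤ ∑ _w : Fin N, (6 : ℝ) :=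
      Finset.sum_le_sum fun w _ => (Finset.sum_le_sum fun i hi =>
        (indicator_le hG hd w (Finset.mem_range.1 hi)).2.1).trans
        ((hwin w 2 (by norm_num)).trans (by norm_num : (2 + 2 * 2 : ℝ) ≤ 6))
    simp at this
    linarith
  -- Power mean inequality (Σ y)³ ≤ N² Σ y³, with 64 = 4³; the total 18 N then yields 18/64 = 9/32.
  · have h1 : ∀ i ∈ Finset.range k, edgeWeight G (v i) (v (i + 1)) ^ 3 ≤
        (N : ℝ) ^ 2 / 64 * ∑ w, y i w ^ 3 := by
      intro i _
      rw [hs, div_pow]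
      have := pow_sum_div_card_le_sum_pow (s := Finset.univ) (fun w _ => hy0 i w) 2
      have hN : 0 < (N : ℝ) := by exact_mod_cast a.pos
      rw [Finset.card_univ, Fintype.card_fin, div_le_iff₀ (by positivity)] at this
      norm_num at this ⊢
      linarith
    refine (Finset.sum_le_sum h1).trans ?_
    rw [← Finset.mul_sum, Finset.sum_comm]
    have : ∑ w, ∑ i ∈ Finset.range k, y i w ^ 3 ≤ ∑ _w : Fin N, (18 : ℝ) :=
      Finset.sum_le_sum fun w _ => (Finset.sum_le_sum fun i hi =>
        (indicator_le hG hd w (Finset.mem_range.1 hi)).2.2).trans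
        ((hwin w 8 (by norm_num)).trans (by norm_num : (2 + 2 * 8 : ℝ) ≤ 18))
    simp at this
    nlinarith [mul_le_mul_of_nonneg_left this (sq_nonneg (N : ℝ))]

/-! ### Selection probabilities -/

/-- The probability that node `i` is active and chooses node `j`. -/
def selectionProb {N : ℕ} (G : SimpleGraph (Fin N)) [DecidableRel G.Adj] (i j : Fin N) : ℝ :=
  if G.Adj i j then (N : ℝ)⁻¹ * (G.degree i : ℝ)⁻¹ else 0

lemma selectionProb_nonneg {N : ℕ} (G : SimpleGraph (Fin N)) [DecidableRel G.Adj] (i j : Fin N) :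
    0 ≤ selectionProb G i j := by
  unfold selectionProb; positivity

lemma sum_selectionProb_le {N : ℕ} (G : SimpleGraph (Fin N)) [DecidableRel G.Adj] :
    ∑ i, ∑ j, selectionProb G i j ≤ 1 := by
  have h : ∀ i, ∑ j, selectionProb G i j ≤ (N : ℝ)⁻¹ := by
    intro i
    simp only [selectionProb]
    rw [← Finset.sum_filter, Finset.sum_const, ← SimpleGraph.neighborFinset_eq_filter,
      SimpleGraph.card_neighborFinset_eq_degree, nsmul_eq_mul, mul_left_comm]
    refine mul_le_of_le_one_right (by positivity) mul_inv_le_one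
  refine (Finset.sum_le_sum fun i _ => h i).trans ?_
  rw [Finset.sum_const, Finset.card_univ, Fintype.card_fin, nsmul_eq_mul]
  exact mul_inv_le_one

/-- The harmonic mean of two degrees is at most their arithmetic mean. -/
lemma inv_edgeWeight_le {N : ℕ} {G : SimpleGraph (Fin N)} [DecidableRel G.Adj] {x y : Fin N}
    (h : G.Adj x y) :
    (edgeWeight G x y)⁻¹ ≤ N * (selectionProb G x y + selectionProb G y x) := by
  have hN : (0 : ℝ) < N := by exact_mod_cast x.pos
  have hx : (0 : ℝ) < G.degree x := by exact_mod_cast (G.degree_pos_iff_exists_adj x).2 ⟨y, h⟩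
  have hy : (0 : ℝ) < G.degree y := by exact_mod_cast (G.degree_pos_iff_exists_adj y).2 ⟨x, h.symm⟩
  have e : N * (selectionProb G x y + selectionProb G y x) =
      (G.degree x : ℝ)⁻¹ + (G.degree y : ℝ)⁻¹ := by
    rw [selectionProb, selectionProb, if_pos h, if_pos h.symm]
    field_simp
  rw [e, edgeWeight, inv_add_inv hx.ne' hy.ne', inv_div, div_le_div_iff₀ (by positivity)
    (by positivity)]
  nlinarith [sq_nonneg ((G.degree x : ℝ) - G.degree y)]

lemma edgeWeight_pos {N : ℕ} {G : SimpleGraph (Fin N)} [DecidableRel G.Adj] {x y : Fin N}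
    (h : G.Adj x y) : 0 < edgeWeight G x y := by
  have hx : (0 : ℝ) < G.degree x := by exact_mod_cast (G.degree_pos_iff_exists_adj x).2 ⟨y, h⟩
  unfold edgeWeight; positivity

/-! ### Killing time of a pair in the interchange process -/

/-- The value at `(a, b)` after a tick of the edge `{i, j}`, which kills the pairs `(i, j)`, `(j, i)`
and interchanges the nodes `i` and `j` otherwise. -/
def afterTick {N : ℕ} (f : Fin N → Fin N → ℝ) (i j a b : Fin N) : ℝ :=
  if (i = a ∧ j = b) ∨ (i = b ∧ j = a) then 0 else f (Equiv.swap i j a) (Equiv.swap i j b)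

/-- The expectation of the minimum of `n` and of the killing time of a pair of nodes that follow the
interchange process. -/
def meetingTime {N : ℕ} (p : Fin N → Fin N → ℝ) : ℕ → Fin N → Fin N → ℝ
  | 0 => fun _ _ => 0
  | n + 1 => fun a b =>
    if a = b then 0 else 1 + ∑ i, ∑ j, p i j * afterTick (meetingTime p n) i j a b

lemma meetingTime_succ {N : ℕ} (p : Fin N → Fin N → ℝ) (n : ℕ) (a b : Fin N) :
    meetingTime p (n + 1) a b =
      if a = b then 0 else 1 + ∑ i, ∑ j, p i j * afterTick (meetingTime p n) i j a b := rfl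

lemma meetingTime_self {N : ℕ} (p : Fin N → Fin N → ℝ) (n : ℕ) (a : Fin N) :
    meetingTime p n a a = 0 := by
  cases n <;> simp [meetingTime]

lemma meetingTime_nonneg {N : ℕ} {p : Fin N → Fin N → ℝ} (hp : ∀ i j, 0 ≤ p i j) (n : ℕ)
    (a b : Fin N) : 0 ≤ meetingTime p n a b := by
  induction n generalizing a b with
  | zero => simp [meetingTime]
  | succ n ih =>
    rw [meetingTime_succ]
    split_ifs
    · exact le_rfl
    · refine add_nonneg zero_le_one (Finset.sum_nonneg fun i _ => Finset.sum_nonneg fun j _ =>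
        mul_nonneg (hp i j) ?_)
      unfold afterTick
      split_ifs
      · exact le_rfl
      · exact ih _ _

lemma meetingTime_comm {N : ℕ} (p : Fin N → Fin N → ℝ) (n : ℕ) (a b : Fin N) :
    meetingTime p n a b = meetingTime p n b a := by
  induction n generalizing a b with
  | zero => simp [meetingTime]
  | succ n ih =>
    simp only [meetingTime, eq_comm (a := a) (b := b), afterTick]
    simp only [ih (Equiv.swap _ _ a), or_comm]

/-- Monotonicity in the truncation makes h = `meetingTime p n` satisfy h ≤ 1 + Ph off the diagonal,
with no need to know that the untruncated expectation is finite. -/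
lemma meetingTime_le_succ {N : ℕ} {p : Fin N → Fin N → ℝ} (hp : ∀ i j, 0 ≤ p i j) (n : ℕ)
    (a b : Fin N) : meetingTime p n a b ≤ meetingTime p (n + 1) a b := by
  induction n generalizing a b with
  | zero => exact meetingTime_nonneg hp _ _ _
  | succ n ih =>
    rw [meetingTime_succ, meetingTime_succ]
    split_ifs
    · exact le_rfl
    · refine add_le_add le_rfl (Finset.sum_le_sum fun i _ => Finset.sum_le_sum fun j _ =>
        mul_le_mul_of_nonneg_left ?_ (hp i j))
      unfold afterTick
      split_ifs
      · exact le_rfl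
      · exact ih _ _

/-- The contribution of the edge `{i, j}` to the energy of `f`. -/
def edgeEnergy {N : ℕ} (f : Fin N → Fin N → ℝ) (i j : Fin N) : ℝ :=
  (∑ a, ∑ b, (f a b - f (Equiv.swap i j a) (Equiv.swap i j b)) ^ 2) / 2 + 2 * f i j ^ 2

lemma edgeEnergy_nonneg {N : ℕ} (f : Fin N → Fin N → ℝ) (i j : Fin N) :
    0 ≤ edgeEnergy f i j := by
  unfold edgeEnergy; positivity

lemma edgeEnergy_comm {N : ℕ} {f : Fin N → Fin N → ℝ} (hf : ∀ a b, f a b = f b a) (i j : Fin N) :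
    edgeEnergy f i j = edgeEnergy f j i := by
  unfold edgeEnergy
  rw [Equiv.swap_comm, hf i j]

/-- Polarization: f(f − f∘σ) = (f − f∘σ)²/2 + (f² − (f∘σ)²)/2, and the last term sums to zero
because the swap σ is a bijection. By symmetry of f the killed pairs (i, j) and (j, i) have no
gradient, and each contributes f(i, j)². -/
lemma sum_mul_sub_afterTick {N : ℕ} {f : Fin N → Fin N → ℝ} (hf : ∀ a b, f a b = f b a)
    (hf0 : ∀ a, f a a = 0) (i j : Fin N) :
    ∑ a, ∑ b, f a b * (f a b - afterTick f i j a b) = edgeEnergy f i j := by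
  set σ := Equiv.swap i j with hσ
  have h1 : ∀ a b, f a b * (f a b - afterTick f i j a b) =
      (f a b - f (σ a) (σ b)) ^ 2 / 2 + (f a b ^ 2 / 2 - f (σ a) (σ b) ^ 2 / 2) +
      ((if a = i then if b = j then f i j ^ 2 else 0 else 0) +
       (if a = j then if b = i then f i j ^ 2 else 0 else 0)) := by
    intro a b
    unfold afterTick
    by_cases hij : i = j
    · subst hij
      simp only [hf0, ← hσ]
      by_cases h : i = a ∧ i = b
      · obtain ⟨rfl, rfl⟩ := h
        simp [hf0]
      · rw [if_neg (by tauto), hσ, Equiv.swap_self]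
        simp
    · by_cases h1 : i = a ∧ j = b
      · obtain ⟨rfl, rfl⟩ := h1
        simp [hσ, hij, hf j i]; ring
      · by_cases h2 : i = b ∧ j = a
        · obtain ⟨rfl, rfl⟩ := h2
          simp [hσ, hij, Ne.symm hij, hf j i]; ring
        · rw [if_neg (by tauto)]
          have e1 : (if a = i then if b = j then f i j ^ 2 else 0 else 0) = 0 := by
            split_ifs <;> simp_all
          have e2 : (if a = j then if b = i then f i j ^ 2 else 0 else 0) = 0 := by
            split_ifs <;> simp_all
          rw [e1, e2]; ring
  have h2 : ∑ a, ∑ b, f (σ a) (σ b) ^ 2 / 2 = ∑ a, ∑ b, f a b ^ 2 / 2 := by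
    rw [Equiv.sum_comp σ (fun a => ∑ b, f a (σ b) ^ 2 / 2)]
    exact Finset.sum_congr rfl fun a _ => Equiv.sum_comp σ (fun b => f a b ^ 2 / 2)
  simp_rw [h1, Finset.sum_add_distrib, Finset.sum_sub_distrib, h2]
  simp [edgeEnergy, ← Finset.sum_div, ← hσ]
  ring

lemma sum_comm_pairs {V : Type*} [Fintype V] (F : V → V → V → V → ℝ) :
    ∑ i, ∑ j, ∑ a, ∑ b, F i j a b = ∑ a, ∑ b, ∑ i, ∑ j, F i j a b := by
  simp_rw [← Fintype.sum_prod_type' (f := fun a b => F _ _ a b)]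
  rw [← Fintype.sum_prod_type' (f := fun i j => ∑ q : V × V, F i j q.1 q.2), Finset.sum_comm,
    Fintype.sum_prod_type]
  exact Finset.sum_congr rfl fun a _ => Finset.sum_congr rfl fun b _ =>
    Fintype.sum_prod_type' fun i j => F i j a b

/-- Total mass below one only helps: the missing mass acts as additional killing. -/
lemma sum_edgeEnergy_le {N : ℕ} {p : Fin N → Fin N → ℝ} (hp1 : ∑ i, ∑ j, p i j ≤ 1)
    {f : Fin N → Fin N → ℝ} (hf : ∀ a b, f a b = f b a) (hf0 : ∀ a, f a a = 0) :
    ∑ i, ∑ j, p i j * edgeEnergy f i j ≤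
      ∑ a, ∑ b, f a b * (f a b - ∑ i, ∑ j, p i j * afterTick f i j a b) := by
  have h1 : ∑ i, ∑ j, p i j * edgeEnergy f i j =
      ∑ a, ∑ b, ∑ i, ∑ j, p i j * (f a b * (f a b - afterTick f i j a b)) := by
    simp_rw [← sum_mul_sub_afterTick hf hf0, Finset.mul_sum]
    rw [sum_comm_pairs]
  rw [h1]
  refine Finset.sum_le_sum fun a _ => Finset.sum_le_sum fun b _ => ?_
  have h2 : ∑ i, ∑ j, p i j * (f a b * (f a b - afterTick f i j a b)) =
      f a b ^ 2 * (∑ i, ∑ j, p i j) - f a b * ∑ i, ∑ j, p i j * afterTick f i j a b := by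
    simp_rw [Finset.mul_sum, ← Finset.sum_sub_distrib]
    exact Finset.sum_congr rfl fun i _ => Finset.sum_congr rfl fun j _ => by ring
  rw [h2]
  nlinarith [mul_le_mul_of_nonneg_left hp1 (sq_nonneg (f a b))]

/-- Each b in `B` gives four ordered pairs, (x, b), (y, b), (b, x), (b, y), with the same squared
gradient; half of four is the factor 2. -/
lemma le_edgeEnergy {N : ℕ} {f : Fin N → Fin N → ℝ} (hf : ∀ a b, f a b = f b a) {x y : Fin N}
    (hxy : x ≠ y) (B : Finset (Fin N)) (hx : x ∉ B) (hy : y ∉ B) :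
    2 * ((∑ b ∈ B, (f x b - f y b) ^ 2) + f x y ^ 2) ≤ edgeEnergy f x y := by
  set g : Fin N → Fin N → ℝ :=
    fun a b => (f a b - f (Equiv.swap x y a) (Equiv.swap x y b)) ^ 2 with hg
  have hg0 : ∀ a b, 0 ≤ g a b := fun a b => sq_nonneg _
  have hB : ∀ b ∈ B, Equiv.swap x y b = b := fun b hb =>
    Equiv.swap_apply_of_ne_of_ne (by rintro rfl; exact hx hb) (by rintro rfl; exact hy hb)
  have g1 : ∀ b ∈ B, g x b = (f x b - f y b) ^ 2 := fun b hb => by simp [hg, hB b hb]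
  have g2 : ∀ b ∈ B, g y b = (f x b - f y b) ^ 2 := fun b hb => by simp [hg, hB b hb]; ring
  have g3 : ∀ b ∈ B, g b x = (f x b - f y b) ^ 2 := fun b hb => by
    simp [hg, hB b hb, hf b]
  have g4 : ∀ b ∈ B, g b y = (f x b - f y b) ^ 2 := fun b hb => by
    simp [hg, hB b hb, hf b]; ring
  have s1 : ∑ b ∈ B, (f x b - f y b) ^ 2 ≤ ∑ b, g x b := by
    rw [← Finset.sum_congr rfl g1]
    exact Finset.sum_le_univ_sum_of_nonneg (hg0 x)
  have s2 : ∑ b ∈ B, (f x b - f y b) ^ 2 ≤ ∑ b, g y b := by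
    rw [← Finset.sum_congr rfl g2]
    exact Finset.sum_le_univ_sum_of_nonneg (hg0 y)
  have s3 : ∑ a ∈ B, 2 * (f x a - f y a) ^ 2 ≤ ∑ a ∈ B, ∑ b, g a b := by
    refine Finset.sum_le_sum fun a ha => ?_
    have := Finset.sum_le_univ_sum_of_nonneg (s := {x, y}) (hg0 a)
    rw [Finset.sum_pair hxy, g3 a ha, g4 a ha] at this
    linarith
  have s4 := Finset.sum_le_univ_sum_of_nonneg (s := insert x (insert y B))
    (f := fun a => ∑ b, g a b) (fun a => Finset.sum_nonneg fun b _ => hg0 a b)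
  rw [Finset.sum_insert (by simp [hxy, hx]), Finset.sum_insert hy] at s4
  rw [← Finset.mul_sum] at s3
  unfold edgeEnergy
  linarith

/-- Injectivity of the path makes all its directed edges, in both orientations, distinct. -/
lemma sum_path_le {V : Type*} [Fintype V] [DecidableEq V] (w : V → V → ℝ) (hw : ∀ x y, 0 ≤ w x y)
    (v : ℕ → V) (k : ℕ) (hv : ∀ i ≤ k, ∀ j ≤ k, v i = v j → i = j) :
    ∑ i ∈ Finset.range k, (w (v i) (v (i + 1)) + w (v (i + 1)) (v i)) ≤ ∑ x, ∑ y, w x y := by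
  rw [← Fintype.sum_prod_type', Finset.sum_add_distrib]
  set P : Finset (V × V) := (Finset.range k).image fun i => (v i, v (i + 1))
  set Q : Finset (V × V) := (Finset.range k).image fun i => (v (i + 1), v i)
  have hP : ∑ i ∈ Finset.range k, w (v i) (v (i + 1)) = ∑ q ∈ P, w q.1 q.2 := by
    rw [Finset.sum_image]
    intro i hi j hj h
    have hi := Finset.mem_range.1 hi
    have hj := Finset.mem_range.1 hj
    exact hv i hi.le j hj.le (Prod.ext_iff.1 h).1
  have hQ : ∑ i ∈ Finset.range k, w (v (i + 1)) (v i) = ∑ q ∈ Q, w q.1 q.2 := by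
    rw [Finset.sum_image]
    intro i hi j hj h
    have hi := Finset.mem_range.1 hi
    have hj := Finset.mem_range.1 hj
    exact hv i hi.le j hj.le (Prod.ext_iff.1 h).2
  have hd : Disjoint P Q := by
    rw [Finset.disjoint_left]
    intro q h1 h2
    obtain ⟨i, hi, rfl⟩ := Finset.mem_image.1 h1
    obtain ⟨j, hj, h⟩ := Finset.mem_image.1 h2
    have hi := Finset.mem_range.1 hi
    have hj := Finset.mem_range.1 hj
    have e1 := hv _ hj _ hi.le (Prod.ext_iff.1 h).1
    have e2 := hv _ hj.le _ hi (Prod.ext_iff.1 h).2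
    omega
  rw [hP, hQ, ← Finset.sum_union hd]
  exact Finset.sum_le_univ_sum_of_nonneg fun q => hw _ _

/-- A symmetric function on pairs of nodes that vanishes on the diagonal is bounded by its energy. -/
lemma sq_le_energy {N : ℕ} {G : SimpleGraph (Fin N)} [DecidableRel G.Adj] (hG : G.Connected)
    {f : Fin N → Fin N → ℝ} (hf : ∀ a b, f a b = f b a) (hf0 : ∀ a, f a a = 0) (a b : Fin N) :
    f a b ^ 2 ≤ 8 / 27 * (N : ℝ) ^ 2 * ∑ i, ∑ j, selectionProb G i j * edgeEnergy f i j := by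
  have hE0 : 0 ≤ ∑ i, ∑ j, selectionProb G i j * edgeEnergy f i j :=
    Finset.sum_nonneg fun i _ => Finset.sum_nonneg fun j _ =>
      mul_nonneg (selectionProb_nonneg G i j) (edgeEnergy_nonneg f i j)
  have hN : (0 : ℝ) < N := by exact_mod_cast a.pos
  by_cases hab : a = b
  · subst hab; rw [hf0, zero_pow two_ne_zero]; exact mul_nonneg (by positivity) hE0
  obtain ⟨v, hva, hvb, hadj, hd⟩ := exists_geodesic hG a b
  have hkpos : 0 < G.dist a b := hG.pos_dist_of_ne hab
  generalize G.dist a b = k at *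
  have hv : ∀ i ≤ k, ∀ j ≤ k, v i = v j → i = j := fun i hi j hj h => by
    rw [← hd i hi, ← hd j hj, h]
  set s : ℕ → ℝ := fun i => edgeWeight G (v i) (v (i + 1)) with hsdef
  have hs : ∀ i < k, 0 < s i := fun i hi => edgeWeight_pos (hadj i hi)
  obtain ⟨b1, b2, b3⟩ := edgeWeight_bounds hG hd
  have hcorner := sq_corner_le (fun i j => f (v i) (v j)) s k hs (fun i => hf0 _)
  simp only [hva, hvb] at hcorner
  set D : ℕ → ℝ := fun i => (∑ m ∈ Finset.range (i + 1), (f (v m) (v (i + 1)) - f (v m) (v i)) ^ 2) +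
        if i + 1 < k then (f (v i) b - f (v (i + 1)) b) ^ 2 else 0 with hD
  have hD0 : ∀ i, 0 ≤ D i := fun i => by simp only [hD]; positivity
  have hDY : ∀ i < k, 2 * D i ≤ edgeEnergy f (v i) (v (i + 1)) := by
    intro i hi
    -- Partners of the moving node: the earlier path vertices, and the endpoint b while it differs
    -- from `v (i + 1)`. The term m = i of `D` reduces to f(v i, v (i + 1))² and is charged to the
    -- killing term.
    set J : Finset ℕ := Finset.range i ∪ if i + 1 < k then {k} else ∅ with hJ
    have hJk : ∀ m ∈ J, m ≤ k ∧ m ≠ i ∧ m ≠ i + 1 := by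
      intro m hm
      simp only [hJ, Finset.mem_union, Finset.mem_range] at hm
      split_ifs at hm <;> simp at hm <;> omega
    have h := le_edgeEnergy hf (hadj i hi).ne (J.image v)
      (by
        intro hm
        obtain ⟨m, hm, h⟩ := Finset.mem_image.1 hm
        exact (hJk m hm).2.1 (hv m (hJk m hm).1 i hi.le h))
      (by
        intro hm
        obtain ⟨m, hm, h⟩ := Finset.mem_image.1 hm
        exact (hJk m hm).2.2 (hv m (hJk m hm).1 (i + 1) hi h))
    rw [Finset.sum_image (fun m hm m' hm' h => hv m (hJk m hm).1 m' (hJk m' hm').1 h)] at h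
    refine le_trans (le_of_eq ?_) h
    have hdisj : Disjoint (Finset.range i) (if i + 1 < k then {k} else ∅) := by
      split_ifs
      · simp; omega
      · simp
    rw [hJ, Finset.sum_union hdisj, hD]
    simp only [Finset.sum_range_succ, hf0, sub_zero]
    have e : ∀ m, (f (v m) (v (i + 1)) - f (v m) (v i)) ^ 2 =
        (f (v i) (v m) - f (v (i + 1)) (v m)) ^ 2 := fun m => by
      rw [hf (v m), hf (v m)]; ring
    simp only [e]
    split_ifs
    · rw [Finset.sum_singleton, hvb]; ring
    · rw [Finset.sum_empty]; ring
  have hsum : ∑ i ∈ Finset.range k, (s i)⁻¹ * D i ≤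
      N / 2 * ∑ i, ∑ j, selectionProb G i j * edgeEnergy f i j := by
    have := sum_path_le (fun i j => selectionProb G i j * edgeEnergy f i j)
      (fun i j => mul_nonneg (selectionProb_nonneg G i j) (edgeEnergy_nonneg f i j)) v k hv
    refine le_trans ?_ (mul_le_mul_of_nonneg_left this (by positivity))
    rw [Finset.mul_sum]
    refine Finset.sum_le_sum fun i hi => ?_
    have hi := Finset.mem_range.1 hi
    rw [edgeEnergy_comm hf (v (i + 1)), ← add_mul]
    have h1 := inv_edgeWeight_le (hadj i hi)
    have h2 := hDY i hi
    have h3 := mul_le_mul h1 h2 (by linarith [hD0 i]) ((inv_nonneg.2 (hs i hi).le).trans h1)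
    simp only [hsdef]
    linarith
  set S := ∑ i ∈ Finset.range k, s i with hS
  have hSpos : 0 < S := Finset.sum_pos (fun i hi => hs i (Finset.mem_range.1 hi))
    (Finset.nonempty_range_iff.2 hkpos.ne')
  have hcube := cube_add_le hN hSpos.le b2 b3
    (by
      rw [Finset.mul_sum]
      refine Finset.sum_le_sum fun i hi => ?_
      have h1 := b1 i (Finset.mem_range.1 hi)
      have h2 := hs i (Finset.mem_range.1 hi)
      have h3 : s i ^ 2 ≤ (N / 2 : ℝ) ^ 2 := pow_le_pow_left₀ h2.le h1 2
      show s i ^ 3 ≤ _ * s i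
      nlinarith [mul_le_mul_of_nonneg_right h3 h2.le])
    (by
      rw [pow_succ S 2, hS, Finset.mul_sum]
      refine Finset.sum_le_sum fun i hi => ?_
      have h2 := hs i (Finset.mem_range.1 hi)
      have h1 := Finset.single_le_sum (f := s) (fun j hj => (hs j (Finset.mem_range.1 hj)).le) hi
      show s i ^ 3 ≤ _ * s i
      rw [pow_succ]
      exact mul_le_mul_of_nonneg_right (pow_le_pow_left₀ h2.le h1 2) h2.le)
  have h0 : 0 ≤ ∑ i ∈ Finset.range k, (s i)⁻¹ * D i := Finset.sum_nonneg fun i hi =>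
    mul_nonneg (inv_nonneg.2 (hs i (Finset.mem_range.1 hi)).le) (hD0 i)
  have h1 := hcorner.trans (mul_le_mul hcube hsum h0 (by positivity))
  -- The constant is (1/3) · (16/9) N · N/2 = 8N²/27.
  refine le_of_mul_le_mul_left (?_ : (3 * S ^ 2) * _ ≤ (3 * S ^ 2) * _) (by positivity)
  linarith

/-- At a maximizing pair the energy is bounded below by a multiple of the squared maximum and above
by N(N − 1) times the maximum; one factor cancels. -/
lemma meetingTime_le {N : ℕ} {G : SimpleGraph (Fin N)} [DecidableRel G.Adj] (hG : G.Connected)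
    (hN : 2 ≤ N) (n : ℕ) (a b : Fin N) :
    meetingTime (selectionProb G) n a b ≤ N * (8 / 27 * (N : ℝ) ^ 3 - 1) := by
  set f := meetingTime (selectionProb G) n with hf
  have hp := selectionProb_nonneg G
  have hN' : (2 : ℝ) ≤ N := by exact_mod_cast hN
  obtain ⟨⟨a₀, b₀⟩, -, hmax⟩ := Finset.exists_max_image (Finset.univ : Finset (Fin N × Fin N))
    (fun q => f q.1 q.2) ⟨(a, b), Finset.mem_univ _⟩
  have hm : ∀ x y, f x y ≤ f a₀ b₀ := fun x y => hmax (x, y) (Finset.mem_univ _)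
  have hm0 : 0 ≤ f a₀ b₀ := meetingTime_nonneg hp _ _ _
  have hsymm : ∀ x y, f x y = f y x := meetingTime_comm _ _
  have hdiag : ∀ x, f x x = 0 := meetingTime_self _ _
  have h1 := sq_le_energy hG hsymm hdiag a₀ b₀
  have h2 := sum_edgeEnergy_le (sum_selectionProb_le G) hsymm hdiag
  have h3 : ∑ x, ∑ y, f x y * (f x y - ∑ i, ∑ j, selectionProb G i j * afterTick f i j x y) ≤
      ∑ x : Fin N, ∑ y : Fin N, if x = y then 0 else f a₀ b₀ := by
    refine Finset.sum_le_sum fun x _ => Finset.sum_le_sum fun y _ => ?_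
    split_ifs with h
    · subst h; rw [hdiag, zero_mul]
    · have h4 := meetingTime_le_succ hp n x y
      rw [meetingTime_succ, if_neg h, ← hf] at h4
      calc _ ≤ f x y * 1 := mul_le_mul_of_nonneg_left (by linarith) (meetingTime_nonneg hp _ _ _)
        _ ≤ _ := by rw [mul_one]; exact hm x y
  have h4 : ∑ x : Fin N, ∑ y : Fin N, (if x = y then 0 else f a₀ b₀) =
      N * (N - 1) * f a₀ b₀ := by
    have : ∀ x y : Fin N, (if x = y then 0 else f a₀ b₀) =
        f a₀ b₀ - if x = y then f a₀ b₀ else 0 := fun x y => by split_ifs <;> simp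
    simp [this, Finset.sum_sub_distrib]
    ring
  have h5 : f a₀ b₀ ^ 2 ≤ 8 / 27 * (N : ℝ) ^ 2 * (N * (N - 1) * f a₀ b₀) :=
    h1.trans (mul_le_mul_of_nonneg_left (h2.trans (h3.trans h4.le)) (by positivity))
  refine (hm a b).trans ?_
  have h6 : f a₀ b₀ ≤ 8 / 27 * (N : ℝ) ^ 2 * (N * (N - 1)) := by
    rcases hm0.eq_or_lt with h | h
    · rw [← h]
      have : (0 : ℝ) ≤ N - 1 := by linarith
      positivity
    · refine le_of_mul_le_mul_right ?_ h
      linarith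
  -- It remains that 8N³/27 ≥ N, which holds since N² ≥ 4 > 27/8.
  refine h6.trans ?_
  nlinarith [mul_le_mul hN' hN' (by norm_num) (by linarith),
    mul_nonneg (by linarith : (0 : ℝ) ≤ N) (by nlinarith : (0 : ℝ) ≤ (N : ℝ) ^ 2 - 4)]

/-! ### Effect of one tick on values, average and deviation -/

lemma exchange_int {Δ : ℝ} (hΔ : 0 < Δ) (n : ℤ) :
    exchange Δ (n * Δ) = (((n + 1) / 2 : ℤ) : ℝ) * Δ := by
  unfold exchange
  rcases Int.even_or_odd' n with ⟨m, rfl | rfl⟩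
  · rw [if_pos ⟨m, by push_cast; field_simp⟩]
    have : (2 * m + 1) / 2 = m := by omega
    rw [this]; push_cast; ring
  · rw [if_neg]
    · have h1 : (2 * m + 1 + 1) / 2 = m + 1 := by omega
      have h2 : ⌊((2 * m + 1 : ℤ) : ℝ) * Δ / 2 / Δ⌋ = m := by
        rw [Int.floor_eq_iff]
        have : ((2 * m + 1 : ℤ) : ℝ) * Δ / 2 / Δ = m + 1 / 2 := by push_cast; field_simp
        rw [this]
        constructor <;> linarith
      rw [quantize, h1, h2]; push_cast; ring
    · rintro ⟨k, hk⟩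
      have : ((2 * m + 1 : ℤ) : ℝ) = (2 * k : ℤ) := by
        field_simp at hk
        push_cast at hk ⊢
        linarith
      have := Int.cast_injective this
      omega

/-- A tick of the edge `{i, j}` moves `t` units from `i` to `j`. -/
lemma exists_step {N : ℕ} {Δ : ℝ} (hΔ : 0 < Δ) {x : Fin N → ℝ} {z : Fin N → ℤ}
    (hz : ∀ k, x k = z k * Δ) {i j : Fin N} (hij : i ≠ j) :
    ∃ t : ℤ, step Δ x i j i = (z i - t : ℤ) * Δ ∧ step Δ x i j j = (z j + t : ℤ) * Δ ∧
      (∀ k, k ≠ i → k ≠ j → step Δ x i j k = x k) ∧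
      (|z i - z j| ≤ 1 → t = z i - z j) ∧ (2 ≤ |z i - z j| → 1 ≤ t * (z i - z j - t)) := by
  have habs : |x i - x j| = ((|z i - z j| : ℤ) : ℝ) * Δ := by
    rw [hz, hz, ← sub_mul, abs_mul, abs_of_pos hΔ]; push_cast; rfl
  have hge : x i ≥ x j ↔ z j ≤ z i := by
    rw [hz, hz, ge_iff_le, mul_le_mul_iff_left₀ hΔ, Int.cast_le]
  by_cases h : z j ≤ z i
  · refine ⟨(|z i - z j| + 1) / 2, ?_, ?_, ?_, ?_, ?_⟩
    · rw [step]
      simp only [habs, exchange_int hΔ, hge, if_pos h, if_true]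
      rw [hz i]; push_cast; ring
    · rw [step]
      simp only [habs, exchange_int hΔ, hge, if_pos h, if_true, hij.symm, if_false]
      rw [hz j]; push_cast; ring
    · intro k h1 h2
      simp [step, hge, h, h1, h2]
    · rw [abs_of_nonneg (by omega)]; omega
    · rw [abs_of_nonneg (by omega)]
      intro h2
      nlinarith [mul_nonneg (by omega : 0 ≤ (z i - z j + 1) / 2 - 1)
        (by omega : 0 ≤ z i - z j - (z i - z j + 1) / 2 - 1),
        (by omega : 0 ≤ z i - z j - (z i - z j + 1) / 2 - 1),
        (by omega : 0 ≤ (z i - z j + 1) / 2 - 1)]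
  · refine ⟨-((|z i - z j| + 1) / 2), ?_, ?_, ?_, ?_, ?_⟩
    · rw [step]
      simp only [habs, exchange_int hΔ, hge, if_neg h, if_true]
      rw [hz i]; push_cast; ring
    · rw [step]
      simp only [habs, exchange_int hΔ, hge, if_neg h, if_true, hij.symm, if_false]
      rw [hz j]; push_cast; ring
    · intro k h1 h2
      simp [step, hge, h, h1, h2]
    · rw [abs_of_neg (by omega)]; omega
    · rw [abs_of_neg (by omega)]
      intro h2
      nlinarith [mul_nonneg (by omega : 0 ≤ (-(z i - z j) + 1) / 2 - 1)
        (by omega : 0 ≤ -(z i - z j) - (-(z i - z j) + 1) / 2 - 1),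
        (by omega : 0 ≤ -(z i - z j) - (-(z i - z j) + 1) / 2 - 1),
        (by omega : 0 ≤ (-(z i - z j) + 1) / 2 - 1)]

lemma sum_eq_of_eq_off_pair {N : ℕ} (g h : Fin N → ℝ) {i j : Fin N} (hij : i ≠ j)
    (he : ∀ k, k ≠ i → k ≠ j → g k = h k) :
    ∑ k, g k = ∑ k, h k + ((g i - h i) + (g j - h j)) := by
  have := Fintype.sum_eq_add (f := fun k => g k - h k) i j hij
    (fun k hk => sub_eq_zero.2 (he k hk.1 hk.2))
  rw [Finset.sum_sub_distrib] at this
  linarith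

lemma isMultiple_step {N : ℕ} {Δ : ℝ} (hΔ : 0 < Δ) {x : Fin N → ℝ}
    (hx : ∀ k, IsMultiple Δ (x k)) {i j : Fin N} (hij : i ≠ j) (k : Fin N) :
    IsMultiple Δ (step Δ x i j k) := by
  choose z hz using hx
  obtain ⟨t, h1, h2, h3, -⟩ := exists_step hΔ hz hij
  by_cases hi : k = i
  · subst hi; exact ⟨_, h1⟩
  by_cases hj : k = j
  · subst hj; exact ⟨_, h2⟩
  · rw [h3 k hi hj]; exact ⟨_, hz k⟩

lemma average_step {N : ℕ} {Δ : ℝ} (hΔ : 0 < Δ) {x : Fin N → ℝ}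
    (hx : ∀ k, IsMultiple Δ (x k)) {i j : Fin N} (hij : i ≠ j) :
    average (step Δ x i j) = average x := by
  choose z hz using hx
  obtain ⟨t, h1, h2, h3, -⟩ := exists_step hΔ hz hij
  unfold average
  rw [sum_eq_of_eq_off_pair _ _ hij h3, h1, h2, hz i, hz j]
  push_cast
  ring

/-- Values less than two steps apart differ by 0 or 1 unit, and half of that rounded up is the whole
difference. -/
lemma step_eq_comp_swap {N : ℕ} {Δ : ℝ} (hΔ : 0 < Δ) {x : Fin N → ℝ}
    (hx : ∀ k, IsMultiple Δ (x k)) {i j : Fin N} (hij : i ≠ j) (h : |x i - x j| < 2 * Δ) :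
    step Δ x i j = x ∘ Equiv.swap i j := by
  choose z hz using hx
  obtain ⟨t, h1, h2, h3, h4, -⟩ := exists_step hΔ hz hij
  have ht := h4 (by
    rw [hz, hz, ← sub_mul, abs_mul, abs_of_pos hΔ, mul_lt_mul_iff_left₀ hΔ] at h
    have : |z i - z j| < 2 := by exact_mod_cast h
    omega)
  funext k
  by_cases hi : k = i
  · subst hi; simp [h1, ht, hz]
  by_cases hj : k = j
  · subst hj; simp [h2, ht, hz]
  · rw [h3 k hi hj, Function.comp, Equiv.swap_apply_of_ne_of_ne hi hj]

/-- The sum of the squared deviations from `c`. -/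
def deviation {N : ℕ} (c : ℝ) (x : Fin N → ℝ) : ℝ := ∑ k, (x k - c) ^ 2

lemma deviation_comp_perm {N : ℕ} (c : ℝ) (x : Fin N → ℝ) (σ : Equiv.Perm (Fin N)) :
    deviation c (x ∘ σ) = deviation c x :=
  Equiv.sum_comp σ fun k => (x k - c) ^ 2

/-- Moving t of the d units of difference lowers the sum of squares by 2t(d − t)Δ², whatever the
centre c, and t(d − t) ≥ 1 once d ≥ 2. -/
lemma deviation_step_le {N : ℕ} {Δ : ℝ} (hΔ : 0 < Δ) (c : ℝ) {x : Fin N → ℝ}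
    (hx : ∀ k, IsMultiple Δ (x k)) {i j : Fin N} (hij : i ≠ j) (h : 2 * Δ ≤ |x i - x j|) :
    deviation c (step Δ x i j) + 2 * Δ ^ 2 ≤ deviation c x := by
  choose z hz using hx
  obtain ⟨t, h1, h2, h3, -, h4⟩ := exists_step hΔ hz hij
  have ht := h4 (by
    rw [hz, hz, ← sub_mul, abs_mul, abs_of_pos hΔ, mul_le_mul_iff_left₀ hΔ] at h
    exact_mod_cast h)
  have ht' : (1 : ℝ) ≤ t * (z i - z j - t) := by exact_mod_cast ht
  unfold deviation
  rw [sum_eq_of_eq_off_pair _ (fun k => (x k - c) ^ 2) hij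
    (fun k h h' => by rw [h3 k h h']), h1, h2, hz i, hz j]
  push_cast
  nlinarith [mul_le_mul_of_nonneg_right ht' (sq_nonneg Δ)]

/-- Keeps the coefficient deviation/(2Δ²) − 1 in `unsettledTime_le` nonnegative. -/
lemma le_deviation {N : ℕ} {Δ : ℝ} (hΔ : 0 < Δ) (c : ℝ) {x : Fin N → ℝ} {a b : Fin N}
    (h : 2 * Δ ≤ x a - x b) : 2 * Δ ^ 2 ≤ deviation c x := by
  have hab : a ≠ b := by rintro rfl; linarith
  have := Finset.sum_le_univ_sum_of_nonneg (s := {a, b}) fun k => sq_nonneg (x k - c)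
  rw [Finset.sum_pair hab] at this
  unfold deviation
  nlinarith [sq_nonneg (x a + x b - 2 * c), mul_self_le_mul_self (by linarith) h]

/-- Popoviciu's inequality. -/
lemma deviation_average_le {N : ℕ} [NeZero N] (x : Fin N → ℝ) :
    deviation (average x) x ≤ N * ((⨆ i, x i) - ⨅ i, x i) ^ 2 / 4 := by
  set A := ⨅ i, x i
  set B := ⨆ i, x i
  have hA : ∀ k, A ≤ x k := fun k => ciInf_le (Set.finite_range x).bddBelow k
  have hB : ∀ k, x k ≤ B := fun k => le_ciSup (Set.finite_range x).bddAbove k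
  have hN : (N : ℝ) ≠ 0 := NeZero.ne _
  have hsum : ∑ k, x k = N * average x := by unfold average; field_simp
  -- Summand by summand this is (x k − A)(B − x k) ≥ 0.
  have h : deviation (average x) x ≤
      ∑ k, ((A + B - 2 * average x) * x k + (average x ^ 2 - A * B)) :=
    Finset.sum_le_sum fun k _ => by
      nlinarith [mul_nonneg (sub_nonneg.2 (hA k)) (sub_nonneg.2 (hB k))]
  rw [Finset.sum_add_distrib, ← Finset.mul_sum, hsum, Finset.sum_const, Finset.card_univ,
    Fintype.card_fin, nsmul_eq_mul] at h
  nlinarith [mul_nonneg (Nat.cast_nonneg (α := ℝ) N) (sq_nonneg (A + B - 2 * average x))]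

/-! ### The consensus set -/

lemma abs_sub_lt_of_mem {N : ℕ} {Δ : ℝ} (hΔ : 0 < Δ) {x₀ x : Fin N → ℝ}
    (hx : x ∈ consensusSet Δ x₀) (i j : Fin N) : |x i - x j| < 2 * Δ := by
  unfold consensusSet at hx
  rw [abs_lt]
  split_ifs at hx
  · rw [hx i, hx j]; constructor <;> linarith
  · rcases hx i with h | h <;> rcases hx j with h' | h' <;> rw [h, h'] <;> constructor <;> linarith

lemma comp_mem_consensusSet {N : ℕ} {Δ : ℝ} {x₀ x : Fin N → ℝ} (hx : x ∈ consensusSet Δ x₀)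
    (σ : Fin N → Fin N) : x ∘ σ ∈ consensusSet Δ x₀ := by
  unfold consensusSet at hx ⊢
  split_ifs at hx ⊢ <;> exact fun i => hx (σ i)

/-- The integer levels span at most one unit. If the mean is a level, all values lie on one side of
it, hence equal it. Otherwise some value lies below the mean and some above, so only the two
adjacent levels occur. -/
lemma mem_consensusSet {N : ℕ} [NeZero N] {Δ : ℝ} (hΔ : 0 < Δ) {x₀ x : Fin N → ℝ}
    (hx : ∀ k, IsMultiple Δ (x k)) (havg : average x = average x₀)
    (h : ∀ i j, x i - x j < 2 * Δ) : x ∈ consensusSet Δ x₀ := by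
  choose z hz using hx
  have hN : (0 : ℝ) < N := Nat.cast_pos.2 (NeZero.pos N)
  have hsum : ∑ k, x k = N * average x₀ := by rw [← havg]; unfold average; field_simp
  have hz1 : ∀ i j, z i ≤ z j + 1 := by
    intro i j
    have := h i j
    rw [hz, hz, ← sub_mul, mul_lt_mul_iff_left₀ hΔ] at this
    have : z i - z j < 2 := by exact_mod_cast this
    omega
  have hle : ∀ c : ℝ, (∀ k, c ≤ x k) → c ≤ average x₀ ∧ (average x₀ = c → ∀ k, x k = c) := by
    intro c hc
    have h1 : ∑ k, (x k - c) = N * (average x₀ - c) := by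
      rw [Finset.sum_sub_distrib, hsum]; simp; ring
    constructor
    · have : 0 ≤ ∑ k, (x k - c) := Finset.sum_nonneg fun k _ => sub_nonneg.2 (hc k)
      rw [h1] at this
      linarith [nonneg_of_mul_nonneg_right this hN]
    · intro he k
      rw [he, sub_self, mul_zero, Finset.sum_eq_zero_iff_of_nonneg
        fun k _ => sub_nonneg.2 (hc k)] at h1
      linarith [h1 k (Finset.mem_univ k)]
  have hge : ∀ c : ℝ, (∀ k, x k ≤ c) → average x₀ ≤ c ∧ (average x₀ = c → ∀ k, x k = c) := by
    intro c hc
    have h1 : ∑ k, (c - x k) = N * (c - average x₀) := by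
      rw [Finset.sum_sub_distrib, hsum]; simp; ring
    constructor
    · have : 0 ≤ ∑ k, (c - x k) := Finset.sum_nonneg fun k _ => sub_nonneg.2 (hc k)
      rw [h1] at this
      linarith [nonneg_of_mul_nonneg_right this hN]
    · intro he k
      rw [he, sub_self, mul_zero, Finset.sum_eq_zero_iff_of_nonneg
        fun k _ => sub_nonneg.2 (hc k)] at h1
      linarith [h1 k (Finset.mem_univ k)]
  have hcast : ∀ (a : ℤ) k, (a ≤ z k → (a : ℝ) * Δ ≤ x k) ∧ (z k ≤ a → x k ≤ (a : ℝ) * Δ) := by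
    intro a k
    rw [hz]
    exact ⟨fun h => mul_le_mul_of_nonneg_right (Int.cast_le.2 h) hΔ.le,
      fun h => mul_le_mul_of_nonneg_right (Int.cast_le.2 h) hΔ.le⟩
  unfold consensusSet
  split_ifs with hm
  · obtain ⟨a, ha⟩ := hm
    simp only [Set.mem_ofPred_eq]
    by_cases hex : ∃ i, a < z i
    · obtain ⟨i, hi⟩ := hex
      intro k
      rw [ha]
      exact (hle _ fun k => (hcast a k).1 (by have := hz1 i k; omega)).2 ha k
    · push Not at hex
      intro k
      rw [ha]
      exact (hge _ fun k => (hcast a k).2 (hex k)).2 ha k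
  · set a := ⌊average x₀ / Δ⌋ with ha
    have h1 : (a : ℝ) * Δ ≤ average x₀ := (le_div_iff₀ hΔ).1 (Int.floor_le _)
    have h2 : average x₀ < (a + 1 : ℤ) * Δ := by
      push_cast; exact (div_lt_iff₀ hΔ).1 (Int.lt_floor_add_one _)
    have h1' : average x₀ ≠ a * Δ := fun h => hm ⟨a, h⟩
    obtain ⟨i, hi⟩ : ∃ i, z i ≤ a := by
      by_contra! hc
      linarith [(hle _ fun k => (hcast (a + 1) k).1 (hc k)).1]
    obtain ⟨j, hj⟩ : ∃ j, a < z j := by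
      by_contra! hc
      exact h1' (le_antisymm (hge _ fun k => (hcast a k).2 (hc k)).1 h1)
    intro k
    have h3 := hz1 k i
    have h4 := hz1 j k
    obtain h | h : z k = a ∨ z k = a + 1 := by omega
    · left; rw [hz, h, quantize]
    · right; rw [hz, h, quantize]; push_cast; ring

/-! ### Expected time outside the consensus set -/

open Classical in
/-- The expected number of the first `n` ticks at which the state is not in `W(x₀)`, from `x`. -/
def unsettledTime {N : ℕ} (Δ : ℝ) (x₀ : Fin N → ℝ) (p : Fin N → Fin N → ℝ) :
    ℕ → (Fin N → ℝ) → ℝ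
  | 0 => fun _ => 0
  | n + 1 => fun x => (if x ∈ consensusSet Δ x₀ then 0 else 1) +
      ∑ i, ∑ j, p i j * unsettledTime Δ x₀ p n (step Δ x i j)

open Classical in
lemma unsettledTime_succ {N : ℕ} (Δ : ℝ) (x₀ : Fin N → ℝ) (p : Fin N → Fin N → ℝ) (n : ℕ)
    (x : Fin N → ℝ) : unsettledTime Δ x₀ p (n + 1) x =
      (if x ∈ consensusSet Δ x₀ then 0 else 1) +
      ∑ i, ∑ j, p i j * unsettledTime Δ x₀ p n (step Δ x i j) := rfl

lemma unsettledTime_nonneg {N : ℕ} (Δ : ℝ) (x₀ : Fin N → ℝ) {p : Fin N → Fin N → ℝ}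
    (hp : ∀ i j, 0 ≤ p i j) (n : ℕ) (x : Fin N → ℝ) : 0 ≤ unsettledTime Δ x₀ p n x := by
  induction n generalizing x with
  | zero => exact le_rfl
  | succ n ih =>
    rw [unsettledTime_succ]
    refine add_nonneg (by split_ifs <;> norm_num) (Finset.sum_nonneg fun i _ =>
      Finset.sum_nonneg fun j _ => mul_nonneg (hp i j) (ih _))

/-- The consensus set is absorbing: within it every tick of an edge is a swap of values. -/
lemma unsettledTime_eq_zero {N : ℕ} (G : SimpleGraph (Fin N)) [DecidableRel G.Adj] {Δ : ℝ}
    (hΔ : 0 < Δ) {x₀ : Fin N → ℝ} (n : ℕ) {x : Fin N → ℝ} (hx : ∀ k, IsMultiple Δ (x k))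
    (hW : x ∈ consensusSet Δ x₀) : unsettledTime Δ x₀ (selectionProb G) n x = 0 := by
  induction n generalizing x with
  | zero => rfl
  | succ n ih =>
    rw [unsettledTime_succ, if_pos hW, zero_add]
    refine Finset.sum_eq_zero fun i _ => Finset.sum_eq_zero fun j _ => ?_
    by_cases hij : G.Adj i j
    · rw [ih (isMultiple_step hΔ hx hij.ne), mul_zero]
      rw [step_eq_comp_swap hΔ hx hij.ne (abs_sub_lt_of_mem hΔ hW i j)]
      exact comp_mem_consensusSet hW _
    · rw [selectionProb, if_neg hij, zero_mul]

/-- Two nodes whose values differ by at least two steps bound the time to consensus: the squared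
deviation pays for every later pair, and the meeting time for the present one. -/
lemma unsettledTime_le {N : ℕ} [NeZero N] (G : SimpleGraph (Fin N)) [DecidableRel G.Adj] {Δ : ℝ}
    (hΔ : 0 < Δ) {x₀ : Fin N → ℝ} {M : ℝ}
    (hM : ∀ n a b, meetingTime (selectionProb G) n a b ≤ M) (n : ℕ) {x : Fin N → ℝ}
    (hx : ∀ k, IsMultiple Δ (x k)) (havg : average x = average x₀) {a b : Fin N}
    (hab : 2 * Δ ≤ x a - x b) :
    unsettledTime Δ x₀ (selectionProb G) n x ≤
      (deviation (average x₀) x / (2 * Δ ^ 2) - 1) * M + meetingTime (selectionProb G) n a b := by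
  set p := selectionProb G with hpdef
  set c := average x₀
  have hp := selectionProb_nonneg G
  have hM0 : 0 ≤ M := (meetingTime_nonneg hp 0 a b).trans (hM 0 a b)
  have hC : ∀ {y : Fin N → ℝ} {a b : Fin N}, 2 * Δ ≤ y a - y b →
      0 ≤ (deviation c y / (2 * Δ ^ 2) - 1) * M := fun h =>
    mul_nonneg (sub_nonneg.2 ((one_le_div (by positivity)).2 (le_deviation hΔ c h))) hM0
  induction n generalizing x a b with
  | zero => exact add_nonneg (hC hab) (meetingTime_nonneg hp _ _ _)
  | succ n ih =>
    have hne : a ≠ b := by rintro rfl; linarith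
    have hxW : x ∉ consensusSet Δ x₀ := fun h => by
      linarith [le_abs_self (x a - x b), abs_sub_lt_of_mem hΔ h a b]
    rw [unsettledTime_succ, if_neg hxW, meetingTime_succ, if_neg hne]
    set C := (deviation c x / (2 * Δ ^ 2) - 1) * M with hCdef
    have key : ∀ i j, p i j * unsettledTime Δ x₀ p n (step Δ x i j) ≤
        p i j * C + p i j * afterTick (meetingTime p n) i j a b := by
      intro i j
      rw [← mul_add]
      by_cases hij : G.Adj i j
      swap
      · rw [hpdef, selectionProb, if_neg hij, zero_mul, zero_mul]
      refine mul_le_mul_of_nonneg_left ?_ (hp i j)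
      have hx' := isMultiple_step hΔ hx hij.ne
      have havg' := (average_step hΔ hx hij.ne).trans havg
      rcases lt_or_ge |x i - x j| (2 * Δ) with h | h
      · have hs := step_eq_comp_swap hΔ hx hij.ne h
        -- The tracked pair is at least 2Δ apart, so a swap tick cannot be at its own edge and does
        -- not kill it.
        have hcase : ¬((i = a ∧ j = b) ∨ (i = b ∧ j = a)) := by
          rintro (⟨rfl, rfl⟩ | ⟨rfl, rfl⟩)
          · linarith [le_abs_self (x i - x j)]
          · linarith [neg_abs_le (x i - x j)]
        rw [afterTick, if_neg hcase]
        have := ih hx' (a := Equiv.swap i j a) (b := Equiv.swap i j b) (by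
          rw [hs]; simpa using hab) havg'
        rwa [hs, deviation_comp_perm, ← hs] at this
      · have h0 : 0 ≤ afterTick (meetingTime p n) i j a b := by
          unfold afterTick
          split_ifs
          · exact le_rfl
          · exact meetingTime_nonneg hp _ _ _
        refine le_trans ?_ (le_add_of_nonneg_right h0)
        by_cases hW : step Δ x i j ∈ consensusSet Δ x₀
        · rw [unsettledTime_eq_zero G hΔ n hx' hW]; exact hC hab
        · obtain ⟨a', b', hab'⟩ : ∃ a' b', 2 * Δ ≤ step Δ x i j a' - step Δ x i j b' := by
            by_contra! hc
            exact hW (mem_consensusSet hΔ hx' havg' hc)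
          refine (ih hx' hab' havg').trans ?_
          have h1 := hM n a' b'
          have h2 := deviation_step_le hΔ c hx hij.ne h
          -- The drop by one in deviation/(2Δ²) frees one `M`, which pays for the killing time of
          -- the new pair.
          have h3 : deviation c (step Δ x i j) / (2 * Δ ^ 2) + 1 ≤ deviation c x / (2 * Δ ^ 2) := by
            rw [div_add_one (by positivity)]
            exact div_le_div_of_nonneg_right h2 (by positivity)
          nlinarith [mul_le_mul_of_nonneg_right h3 hM0]
    have hsum := Finset.sum_le_sum fun i (_ : i ∈ Finset.univ) =>
      Finset.sum_le_sum fun j (_ : j ∈ Finset.univ) => key i j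
    simp only [Finset.sum_add_distrib, ← Finset.sum_mul] at hsum
    nlinarith [mul_le_mul_of_nonneg_right (sum_selectionProb_le G) (hC hab)]

/-! ### Passage to the random process -/

lemma state_congr {N : ℕ} (Δ : ℝ) (x₀ : Fin N → ℝ) {e e' : ℕ → Fin N × Fin N} {t : ℕ}
    (h : ∀ s < t, e s = e' s) : state Δ x₀ e t = state Δ x₀ e' t := by
  induction t with
  | zero => rfl
  | succ t ih => rw [state, state, ih fun s hs => h s (by omega), h t (by omega)]

/-- The state is a function of the selections at the earlier ticks. -/
lemma exists_state_eq {N : ℕ} [NeZero N] (Δ : ℝ) (x₀ : Fin N → ℝ) (t : ℕ) :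
    ∃ F : (Finset.range t → Fin N × Fin N) → Fin N → ℝ,
      ∀ e : ℕ → Fin N × Fin N, state Δ x₀ e t = F fun s => e s :=
  -- The padding (0, 0) is never read, since the state at t depends only on ticks before t.
  ⟨fun q => state Δ x₀ (fun s => if h : s ∈ Finset.range t then q ⟨s, h⟩ else (0, 0)) t,
    fun e => state_congr Δ x₀ fun s hs => by rw [dif_pos (Finset.mem_range.2 hs)]⟩

lemma IsRandomSelection.law_eq {N : ℕ} {G : SimpleGraph (Fin N)} [DecidableRel G.Adj]
    {Ω : Type*} [MeasurableSpace Ω] {μ : Measure Ω} {e : ℕ → Ω → Fin N × Fin N}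
    (he : IsRandomSelection G μ e) (t : ℕ) (i j : Fin N) :
    μ (e t ⁻¹' {(i, j)}) = ENNReal.ofReal (selectionProb G i j) := by
  have h := he.law t i j
  rw [show e t ⁻¹' {(i, j)} = {ω | e t ω = (i, j)} from rfl, h, selectionProb]
  split_ifs with hij
  · have hN : (0 : ℝ) < N := by exact_mod_cast i.pos
    have hd : (0 : ℝ) < G.degree i := by
      exact_mod_cast (G.degree_pos_iff_exists_adj i).2 ⟨j, hij⟩
    rw [ENNReal.ofReal_mul (by positivity), ENNReal.ofReal_inv_of_pos hN,
      ENNReal.ofReal_inv_of_pos hd, ENNReal.ofReal_natCast, ENNReal.ofReal_natCast]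
  · simp

section

variable {N : ℕ} [NeZero N] {G : SimpleGraph (Fin N)} [DecidableRel G.Adj] {Ω : Type*}
  [MeasurableSpace Ω] {μ : Measure Ω} {e : ℕ → Ω → Fin N × Fin N}

lemma IsRandomSelection.measurable_state (he : IsRandomSelection G μ e) (Δ : ℝ) (x₀ : Fin N → ℝ)
    (t : ℕ) (φ : (Fin N → ℝ) → ℝ≥0∞) :
    Measurable fun ω => φ (state Δ x₀ (fun t => e t ω) t) := by
  obtain ⟨F, hF⟩ := exists_state_eq Δ x₀ t
  simp only [hF]
  exact (Measurable.of_discrete (f := fun q => φ (F q))).comp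
    (measurable_pi_lambda _ fun s => he.measurable s)

/-- Markov property: the state at t is a function of earlier selections, hence independent of the
selection at t. -/
lemma IsRandomSelection.lintegral_succ (he : IsRandomSelection G μ e) (Δ : ℝ) (x₀ : Fin N → ℝ)
    (t : ℕ) (φ : (Fin N → ℝ) → ℝ≥0∞) :
    ∫⁻ ω, φ (state Δ x₀ (fun t => e t ω) (t + 1)) ∂μ =
      ∑ i, ∑ j, ENNReal.ofReal (selectionProb G i j) *
        ∫⁻ ω, φ (step Δ (state Δ x₀ (fun t => e t ω) t) i j) ∂μ := by
  have h1 : ∀ ω, φ (state Δ x₀ (fun t => e t ω) (t + 1)) =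
      ∑ i, ∑ j, (e t ⁻¹' {(i, j)}).indicator 1 ω *
        φ (step Δ (state Δ x₀ (fun t => e t ω) t) i j) := by
    intro ω
    rw [← Fintype.sum_prod_type' (f := fun i j => (e t ⁻¹' {(i, j)}).indicator 1 ω *
        φ (step Δ (state Δ x₀ (fun t => e t ω) t) i j)), Fintype.sum_eq_single (e t ω)]
    · simp [state]
    · intro q hq
      rw [Set.indicator_of_notMem (by simpa using hq.symm), zero_mul]
  have hmeas : ∀ i j, Measurable ((e t ⁻¹' {(i, j)}).indicator (1 : Ω → ℝ≥0∞)) := fun i j =>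
    measurable_one.indicator (he.measurable t (measurableSet_singleton _))
  have hmeas' : ∀ i j, Measurable fun ω => φ (step Δ (state Δ x₀ (fun t => e t ω) t) i j) :=
    fun i j => he.measurable_state Δ x₀ t fun x => φ (step Δ x i j)
  have hmul : ∀ i j, Measurable fun ω => (e t ⁻¹' {(i, j)}).indicator (1 : Ω → ℝ≥0∞) ω *
      φ (step Δ (state Δ x₀ (fun t => e t ω) t) i j) := fun i j => (hmeas i j).mul (hmeas' i j)
  simp_rw [h1]
  rw [lintegral_finsetSum _ fun i _ => Finset.measurable_fun_sum _ fun j _ => hmul i j]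
  refine Finset.sum_congr rfl fun i _ => ?_
  rw [lintegral_finsetSum _ fun j _ => hmul i j]
  refine Finset.sum_congr rfl fun j _ => ?_
  have hind : IndepFun ((e t ⁻¹' {(i, j)}).indicator (1 : Ω → ℝ≥0∞))
      (fun ω => φ (step Δ (state Δ x₀ (fun t => e t ω) t) i j)) μ := by
    obtain ⟨F, hF⟩ := exists_state_eq Δ x₀ t
    simp only [hF]
    have h := he.indep.indepFun_finset {t} (Finset.range t) (by simp) he.measurable
    exact h.comp (φ := fun q => ({(i, j)} : Set (Fin N × Fin N)).indicator (1 : Fin N × Fin N → ℝ≥0∞)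
        (q ⟨t, Finset.mem_singleton_self t⟩))
      (ψ := fun q => φ (step Δ (F q) i j)) Measurable.of_discrete Measurable.of_discrete
  have := lintegral_mul_eq_lintegral_mul_lintegral_of_indepFun (hmeas i j) (hmeas' i j) hind
  simp only [Pi.mul_apply] at this
  rw [this, lintegral_indicator_one (he.measurable t (measurableSet_singleton _)), he.law_eq]

open Classical in
-- The starting time t is kept general because the induction on n conditions on one tick and
-- restarts at t + 1.
lemma IsRandomSelection.sum_lintegral_le (he : IsRandomSelection G μ e) (Δ : ℝ) (x₀ : Fin N → ℝ)
    (n t : ℕ) :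
    ∑ s ∈ Finset.range n, ∫⁻ ω,
        (if state Δ x₀ (fun t => e t ω) (t + s) ∈ consensusSet Δ x₀ then 0 else 1) ∂μ ≤
      ∫⁻ ω, ENNReal.ofReal (unsettledTime Δ x₀ (selectionProb G) n
        (state Δ x₀ (fun t => e t ω) t)) ∂μ := by
  induction n generalizing t with
  | zero => simp
  | succ n ih =>
    have hp := selectionProb_nonneg G
    have hU := fun x => unsettledTime_nonneg Δ x₀ hp n x
    have h1 : ∀ x, ENNReal.ofReal (unsettledTime Δ x₀ (selectionProb G) (n + 1) x) =
        (if x ∈ consensusSet Δ x₀ then 0 else 1) + ∑ i, ∑ j,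
          ENNReal.ofReal (selectionProb G i j) *
          ENNReal.ofReal (unsettledTime Δ x₀ (selectionProb G) n (step Δ x i j)) := by
      intro x
      rw [unsettledTime_succ, ENNReal.ofReal_add (by split_ifs <;> norm_num)
        (Finset.sum_nonneg fun i _ => Finset.sum_nonneg fun j _ => mul_nonneg (hp i j) (hU _)),
        ENNReal.ofReal_sum_of_nonneg
          fun i _ => Finset.sum_nonneg fun j _ => mul_nonneg (hp i j) (hU _)]
      congr 1
      · split_ifs <;> simp
      · refine Finset.sum_congr rfl fun i _ => ?_
        rw [ENNReal.ofReal_sum_of_nonneg fun j _ => mul_nonneg (hp i j) (hU _)]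
        exact Finset.sum_congr rfl fun j _ => ENNReal.ofReal_mul (hp i j)
    have hm : ∀ i j, Measurable fun ω => ENNReal.ofReal (unsettledTime Δ x₀ (selectionProb G) n
        (step Δ (state Δ x₀ (fun t => e t ω) t) i j)) := fun i j =>
      he.measurable_state Δ x₀ t fun x =>
        ENNReal.ofReal (unsettledTime Δ x₀ (selectionProb G) n (step Δ x i j))
    simp_rw [h1]
    rw [lintegral_add_left (he.measurable_state Δ x₀ t fun x =>
      if x ∈ consensusSet Δ x₀ then 0 else 1),
      lintegral_finsetSum _ fun i _ => Finset.measurable_fun_sum _ fun j _ => (hm i j).const_mul _]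
    have h2 : ∀ i, ∫⁻ ω, ∑ j, ENNReal.ofReal (selectionProb G i j) *
          ENNReal.ofReal (unsettledTime Δ x₀ (selectionProb G) n
            (step Δ (state Δ x₀ (fun t => e t ω) t) i j)) ∂μ =
        ∑ j, ENNReal.ofReal (selectionProb G i j) *
          ∫⁻ ω, ENNReal.ofReal (unsettledTime Δ x₀ (selectionProb G) n
            (step Δ (state Δ x₀ (fun t => e t ω) t) i j)) ∂μ := by
      intro i
      rw [lintegral_finsetSum _ fun j _ => (hm i j).const_mul _]
      exact Finset.sum_congr rfl fun j _ => lintegral_const_mul _ (hm i j)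
    simp_rw [h2]
    rw [← he.lintegral_succ Δ x₀ t fun x =>
      ENNReal.ofReal (unsettledTime Δ x₀ (selectionProb G) n x), Finset.sum_range_succ', add_comm]
    refine add_le_add le_rfl ((Finset.sum_congr rfl fun s _ => ?_).trans_le (ih (t + 1)))
    rw [add_right_comm, add_assoc]

end

open Classical in
-- Every tick before the first hitting time contributes one to the sum; if the set is never reached,
-- both sides are infinite.
lemma convergenceTime_le_tsum {N : ℕ} (Δ : ℝ) (x₀ : Fin N → ℝ) (e : ℕ → Fin N × Fin N) :
    convergenceTime Δ x₀ e ≤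
      ∑' t, if state Δ x₀ e t ∈ consensusSet Δ x₀ then 0 else 1 := by
  by_cases h : ∃ t, state Δ x₀ e t ∈ consensusSet Δ x₀
  · refine (iInf₂_le (Nat.find h) (Nat.find_spec h)).trans ?_
    refine le_trans (le_of_eq ?_) (ENNReal.sum_le_tsum (Finset.range (Nat.find h)))
    rw [Finset.sum_congr rfl fun s hs => if_neg (Nat.find_min h (Finset.mem_range.1 hs))]
    simp
  · push Not at h
    simp [h]

end QuantizedAveraging

end

theorem theorem2 {N : ℕ} (G : SimpleGraph (Fin N)) [DecidableRel G.Adj] (hG : G.Connected)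
    {Δ : ℝ} (hΔ : 0 < Δ) (x₀ : Fin N → ℝ)
    (hx₀ : ∀ i, QuantizedAveraging.IsMultiple Δ (x₀ i))
    (hW : x₀ ∉ QuantizedAveraging.consensusSet Δ x₀)
    {Ω : Type*} [MeasurableSpace Ω] (μ : Measure Ω) [IsProbabilityMeasure μ]
    (e : ℕ → Ω → Fin N × Fin N) (he : QuantizedAveraging.IsRandomSelection G μ e) :
    ∫⁻ ω, QuantizedAveraging.convergenceTime Δ x₀ (fun t => e t ω) ∂μ ≤
      ENNReal.ofReal ((N : ℝ) ^ 2 * QuantizedAveraging.rangeJ Δ x₀ ^ 2 / 8 *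
        (8 / 27 * (N : ℝ) ^ 3 - 1)) := by
  open QuantizedAveraging in
  classical
  obtain ⟨i₀⟩ := hG.nonempty
  have : NeZero N := ⟨i₀.pos.ne'⟩
  obtain ⟨a, b, hab⟩ : ∃ a b, 2 * Δ ≤ x₀ a - x₀ b := by
    by_contra! hc
    exact hW (mem_consensusSet hΔ hx₀ rfl hc)
  have hN : 2 ≤ N := by
    have hne : a ≠ b := by rintro rfl; linarith
    have := Fin.val_ne_of_ne hne
    omega
  set M : ℝ := N * (8 / 27 * (N : ℝ) ^ 3 - 1) with hMdef
  have hM : ∀ n a b, meetingTime (selectionProb G) n a b ≤ M := meetingTime_le hG hN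
  have hM0 : 0 ≤ M := (meetingTime_nonneg (selectionProb_nonneg G) 0 a b).trans (hM 0 a b)
  have hbound : ∀ n, unsettledTime Δ x₀ (selectionProb G) n x₀ ≤
      (N : ℝ) ^ 2 * rangeJ Δ x₀ ^ 2 / 8 * (8 / 27 * (N : ℝ) ^ 3 - 1) := by
    intro n
    have h1 := unsettledTime_le G hΔ hM n hx₀ rfl hab
    have h2 := hM n a b
    have h3 : deviation (average x₀) x₀ / (2 * Δ ^ 2) ≤ N * rangeJ Δ x₀ ^ 2 / 8 := by
      rw [div_le_iff₀ (by positivity)]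
      refine (deviation_average_le x₀).trans (le_of_eq ?_)
      unfold rangeJ
      field_simp
      ring
    have h4 := mul_le_mul_of_nonneg_right h3 hM0
    calc _ ≤ deviation (average x₀) x₀ / (2 * Δ ^ 2) * M := by linarith
      _ ≤ _ := h4
      _ = _ := by rw [hMdef]; ring
  calc ∫⁻ ω, convergenceTime Δ x₀ (fun t => e t ω) ∂μ
      ≤ ∫⁻ ω, ∑' t, (if state Δ x₀ (fun t => e t ω) t ∈ consensusSet Δ x₀ then 0 else 1) ∂μ :=
        lintegral_mono fun ω => convergenceTime_le_tsum _ _ _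
    _ = ∑' t, ∫⁻ ω, (if state Δ x₀ (fun t => e t ω) t ∈ consensusSet Δ x₀ then 0 else 1) ∂μ :=
        lintegral_tsum fun t => (he.measurable_state Δ x₀ t fun x =>
          if x ∈ consensusSet Δ x₀ then 0 else 1).aemeasurable
    -- The bound on partial sums is uniform in n, so it passes to the whole series.
    _ ≤ _ := ENNReal.tsum_le_of_sum_range_le fun n => by
      have h := he.sum_lintegral_le Δ x₀ n 0
      simp only [zero_add, state, lintegral_const, measure_univ, mul_one] at h
      exact h.trans (ENNReal.ofReal_le_ofReal (hbound n))
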